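/- Let $G$ be a group with identity element $e$ and let $\Sigma$ be a finite alphabet. A finite automaton over $G$ (or $G$-automaton) with input alphabet $\Sigma$ is a tuple $(Q,\Sigma,G,\delta,q_1,Q_a)$, where $Q$ is a finite set of states, $q_1\in Q$ is the initial state, $Q_a\subseteq Q$ is the set of accept states, and the transition function $\delta$ assigns to every pair in $Q\times(\Sigma\cup\{\varepsilon\})$ a finite subset of $Q\times G$. If $(q',g)\in\delta(q,\sigma)$, then in state $q$ the automaton may read $\sigma$ (reading no input symbol if $\sigma=\varepsilon$), move to state $q'$ and replace the content $x$ of its register by $xg$. A word $w\in\Sigma^*$ is accepted if some computation that starts in $q_1$ with register content $e$ and reads exactly $w$ ends in an accept state with register content $e$. The language recognized by the automaton is the set of all accepted words. Let $\mathfrak{L}(G)$ denote the class of languages recognized by $G$-automata, and let $\mathsf{CF}$ denote the class of context-free languages, i.e. of the languages generated by context-free grammars. Let $\mathbf{F}_2$ be the free group of rank $2$, let $GL(2,\mathbb{Z})$ be the group of invertible $2\times 2$ integer matrices, and let $SL(2,\mathbb{Z})$ be its subgroup of matrices of determinant $1$. Then $$\mathsf{CF}=\mathfrak{L}(\mathbf{F}_2)=\mathfrak{L}(SL(2,\mathbb{Z}))=\mathfrak{L}(GL(2,\mathbb{Z})),$$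 that is, over every finite alphabet these four classes contain the same languages. -/

import Mathlib

/-- A nondeterministic extended finite automaton over the group `G` with input alphabet `α` and
states `Q`: `(q', g) ∈ step q a` means that in state `q`, reading the letter `a` (or nothing, when
`a = none`), the machine may move to `q'` and multiply its register by `g` on the right.
An automaton is a finite object: it has finitely many transitions, hence the `Finset`. Finiteness
of `Q` and of `α` is required where languages and classes of languages are considered. -/
structure ExtendedFA (G α Q : Type*) where
  /-- Transition function. -/
  step : Q → Option α → Finset (Q × G)
  /-- Initial state. -/
  start : Q
  /-- Accept states. -/
  accept : Set Q

namespace ExtendedFA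

/-- `M.Run q x w r y`: some computation of `M` leads from state `q` with register content `x` to
state `r` with register content `y` while consuming exactly the word `w`. -/
inductive Run {G α Q : Type*} [Group G] (M : ExtendedFA G α Q) :
    Q → G → List α → Q → G → Prop
  | refl (q : Q) (x : G) : Run M q x [] q x
  | eps {q q' r : Q} {x g y : G} {w : List α} (h : (q', g) ∈ M.step q none)
      (hr : Run M q' (x * g) w r y) : Run M q x w r y
  | read {q q' r : Q} {x g y : G} {a : α} {w : List α} (h : (q', g) ∈ M.step q (some a))
      (hr : Run M q' (x * g) w r y) : Run M q x (a :: w) r y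

/-- The language recognized by `M`: the words that can be consumed completely by a computation
which starts in the initial state with register `1` and ends in an accept state with register
`1`. -/
def accepts {G α Q : Type*} [Group G] (M : ExtendedFA G α Q) : Language α :=
  {w | ∃ q ∈ M.accept, M.Run M.start 1 w q 1}

end ExtendedFA

/-- The class `𝔏(G)`, over the alphabet `α`: the languages recognized by extended finite automata
over `G` with finitely many states. -/
def groupAutomatonLanguages (G : Type*) [Group G] (α : Type*) : Set (Language α) :=
  {L | ∃ (Q : Type) (_ : Finite Q) (M : ExtendedFA G α Q), M.accepts = L}

/-- The class `CF`, over the alphabet `α`: the languages generated by context-free grammars. -/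
def contextFreeLanguages (α : Type*) : Set (Language α) :=
  {L | L.IsContextFree}

/-! The inclusions form a cycle `CF ⊆ 𝔏(F₂) ⊆ 𝔏(SL) ⊆ 𝔏(GL) ⊆ 𝔏(F₂) ⊆ CF`.

A register over a free group is trivial at the end exactly when the emitted letters cancel in nested
pairs (`LetterRel.balanced_iff_exists_path`). Words read along such balanced paths from `p` to `q`
satisfy a context-free recursion, which gives `𝔏(F₂) ⊆ CF`. Conversely, a recursive descent parser
uses a free group on its return addresses as a stack, and this group embeds in `F₂`.

Injective homomorphisms give the inclusions into `SL` and `GL`, by the Sanov matrices. The way back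
holds because their subgroup has finite index in `GL(2, ℤ)`, and the finite control can remember a
coset. -/

namespace ExtendedFA

/-! ### Automata given by relations, and their runs -/

variable {G H α Q : Type*}

theorem finite_setOf_rel [Finite Q] {R : Q → G → Prop} (hR : ∀ q, {g | R q g}.Finite) :
    {p : Q × G | R p.1 p.2}.Finite := by
  refine (Set.finite_iUnion fun q => (hR q).image (Prod.mk q)).subset ?_
  rintro ⟨q, g⟩ h
  exact Set.mem_iUnion.2 ⟨q, g, h, rfl⟩

/-- The automaton whose transitions are given by a relation that relates any two states, for a
given label, through finitely many group elements only. -/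
noncomputable def ofRel [Finite Q] (R : Q → Option α → Q → G → Prop)
    (hR : ∀ q σ q', {g | R q σ q' g}.Finite) (start : Q) (accept : Set Q) :
    ExtendedFA G α Q where
  step q σ := (finite_setOf_rel (hR q σ)).toFinset
  start := start
  accept := accept

@[simp]
theorem mem_ofRel_step [Finite Q] {R : Q → Option α → Q → G → Prop}
    {hR : ∀ q σ q', {g | R q σ q' g}.Finite} {start : Q} {accept : Set Q} {q q' : Q}
    {σ : Option α} {g : G} :
    (q', g) ∈ (ofRel R hR start accept).step q σ ↔ R q σ q' g := by
  simp [ofRel]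

variable [Group G] [Group H]

theorem Run.step {M : ExtendedFA G α Q} {q q' r : Q} {x g y : G} {σ : Option α} {w : List α}
    (h : (q', g) ∈ M.step q σ) (hr : M.Run q' (x * g) w r y) :
    M.Run q x (σ.toList ++ w) r y := by
  cases σ with
  | none => exact .eps h hr
  | some a => exact .read h hr

/-- Induction on runs that treats both kinds of transitions alike. -/
theorem Run.label_induction {M : ExtendedFA G α Q} {r : Q} {y : G}
    {motive : Q → G → List α → Prop} (refl : motive r y [])
    (step : ∀ {q q' x g σ w}, (q', g) ∈ M.step q σ → M.Run q' (x * g) w r y →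
      motive q' (x * g) w → motive q x (σ.toList ++ w))
    {q : Q} {x : G} {w : List α} (h : M.Run q x w r y) : motive q x w := by
  induction h with
  | refl => exact refl
  | eps h hr ih => exact step (σ := none) h hr (ih refl step)
  | read h hr ih => exact step (σ := some _) h hr (ih refl step)

theorem Run.mul_left {M : ExtendedFA G α Q} {q r : Q} {x y : G} {w : List α}
    (h : M.Run q x w r y) (z : G) : M.Run q (z * x) w r (z * y) := by
  refine h.label_induction (motive := fun q x w => M.Run q (z * x) w r (z * y)) (.refl _ _) ?_
  intro q q' x g σ w hg _ ih
  exact .step hg (by rwa [mul_assoc])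

end ExtendedFA

/-! ### Changing the register group -/

section Transfer

open ExtendedFA

theorem groupAutomatonLanguages_subset_of_injective {G H : Type*} [Group G] [Group H]
    (f : G →* H) (hf : Function.Injective f) (α : Type*) :
    groupAutomatonLanguages G α ⊆ groupAutomatonLanguages H α := by
  rintro _ ⟨Q, hQ, M, rfl⟩
  have hfin (q : Q) (σ : Option α) (q' : Q) :
      {h | ∃ g, (q', g) ∈ M.step q σ ∧ f g = h}.Finite := by
    refine ((M.step q σ).finite_toSet.image fun p => f p.2).subset ?_
    rintro _ ⟨g, hg, rfl⟩
    exact ⟨_, hg, rfl⟩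
  let M' : ExtendedFA H α Q := ofRel _ hfin M.start M.accept
  have run_map {q r : Q} {x y : G} {w : List α} (h : M.Run q x w r y) :
      M'.Run q (f x) w r (f y) := by
    refine h.label_induction (motive := fun q x w => M'.Run q (f x) w r (f y)) (.refl _ _) ?_
    intro q q' x g σ w hg _ ih
    exact .step (mem_ofRel_step.2 ⟨g, hg, rfl⟩) (by rwa [← map_mul])
  have run_comap {q r : Q} {y : H} {w : List α} {x : H} (h : M'.Run q x w r y) :
      ∀ x₀ y₀, f x₀ = x → f y₀ = y → M.Run q x₀ w r y₀ := by
    refine h.label_induction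
      (motive := fun q x w => ∀ x₀ y₀, f x₀ = x → f y₀ = y → M.Run q x₀ w r y₀) ?_ ?_
    · intro x₀ y₀ hx hy
      obtain rfl := hf (hx.trans hy.symm)
      exact .refl _ _
    · rintro q q' x g σ w hg _ ih x₀ y₀ rfl hy
      obtain ⟨g, hg', rfl⟩ := mem_ofRel_step.1 hg
      exact .step hg' (ih _ _ (map_mul _ _ _) hy)
  refine ⟨Q, hQ, M', ?_⟩
  ext w
  constructor
  · rintro ⟨q, hq, h⟩
    exact ⟨q, hq, run_comap h _ _ (map_one f) (map_one f)⟩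
  · rintro ⟨q, hq, h⟩
    exact ⟨q, hq, by simpa [M', ofRel] using run_map h⟩

/-- A register over `G` can be replaced by a register over a subgroup of finite index, as the
finite control can keep track of the coset. -/
theorem groupAutomatonLanguages_subset_of_finiteIndex {G : Type} [Group G] (H : Subgroup G)
    [H.FiniteIndex] (α : Type*) :
    groupAutomatonLanguages G α ⊆ groupAutomatonLanguages H α := by
  rintro _ ⟨Q, hQ, M, rfl⟩
  -- Register `h` with coset `k` stands for the register `h * k.out⁻¹` of `M`, so a transition by
  -- `g` from `k` to `k'` becomes multiplication by `k.out⁻¹ * g * k'.out`.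
  have hfin (p : Q × (G ⧸ H)) (σ : Option α) (p' : Q × (G ⧸ H)) :
      {h : H | ∃ g, (p'.1, g) ∈ M.step p.1 σ ∧ (h : G) = p.2.out⁻¹ * g * p'.2.out}.Finite := by
    refine Set.Finite.of_finite_image (f := ((↑) : H → G)) ?_ Subtype.val_injective.injOn
    refine ((M.step p.1 σ).finite_toSet.image fun t => p.2.out⁻¹ * t.2 * p'.2.out).subset ?_
    rintro _ ⟨_, ⟨g, hg, h⟩, rfl⟩
    exact ⟨_, hg, h.symm⟩
  let κ : G ⧸ H := (1 : G)
  let M' : ExtendedFA H α (Q × (G ⧸ H)) := ofRel _ hfin (M.start, κ) {p | p.1 ∈ M.accept ∧ p.2 = κ}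
  have run_of {r : Q × (G ⧸ H)} {y : H} {w : List α} {q : Q × (G ⧸ H)} {x : H}
      (h : M'.Run q x w r y) : M.Run q.1 (x * q.2.out⁻¹) w r.1 (y * r.2.out⁻¹) := by
    refine h.label_induction (motive := fun (q : Q × (G ⧸ H)) (x : H) w =>
      M.Run q.1 (x * q.2.out⁻¹) w r.1 (y * r.2.out⁻¹)) (.refl _ _) ?_
    intro q q' x h σ w hh _ ih
    obtain ⟨g, hg, hh⟩ := mem_ofRel_step.1 hh
    refine .step hg ?_
    convert! ih using 1
    simp [hh, mul_assoc]
  have of_run {r : Q} {y : G} {w : List α} {q : Q} {x : G} (h : M.Run q x w r y) :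
      ∀ (k k' : G ⧸ H) (x₀ y₀ : H), x = x₀ * k.out⁻¹ → y = y₀ * k'.out⁻¹ →
        M'.Run (q, k) x₀ w (r, k') y₀ := by
    refine h.label_induction (motive := fun q x w => ∀ (k k' : G ⧸ H) (x₀ y₀ : H),
      x = x₀ * k.out⁻¹ → y = y₀ * k'.out⁻¹ → M'.Run (q, k) x₀ w (r, k') y₀) ?_ ?_
    · intro k k' x₀ y₀ hx hy
      have hk : k = k' := by
        rw [← QuotientGroup.out_eq' k, ← QuotientGroup.out_eq' k', QuotientGroup.eq]
        have : k.out⁻¹ * k'.out = ((x₀⁻¹ * y₀ : H) : G) := by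
          have := hx.symm.trans hy
          rw [← mul_inv_eq_iff_eq_mul] at this
          simp [← this, mul_assoc]
        rw [this]
        exact (x₀⁻¹ * y₀).2
      subst hk
      obtain rfl : x₀ = y₀ := Subtype.ext (mul_right_cancel (hx.symm.trans hy))
      exact .refl _ _
    · rintro q q' x g σ w hg _ ih k k' x₀ y₀ rfl hy
      -- The only coset for which the new multiplier lies in `H`.
      let k₁ : G ⧸ H := ((g⁻¹ * k.out : G) : G ⧸ H)
      have hmem : k.out⁻¹ * g * k₁.out ∈ H := by
        have := QuotientGroup.eq.1 (QuotientGroup.out_eq' k₁).symm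
        simpa [mul_assoc] using this
      refine .step (g := ⟨_, hmem⟩) (mem_ofRel_step.2 ⟨g, hg, rfl⟩) (ih k₁ k' _ _ ?_ hy)
      simp [mul_assoc]
  refine ⟨Q × (G ⧸ H), inferInstance, M', ?_⟩
  ext w
  constructor
  · rintro ⟨⟨q, k⟩, ⟨hq, rfl⟩, h⟩
    refine ⟨q, hq, ?_⟩
    -- `κ.out` need not be `1`; left translation of the run removes it.
    simpa [M', ofRel] using (run_of h).mul_left κ.out
  · rintro ⟨q, hq, h⟩
    refine ⟨(q, κ), ⟨hq, rfl⟩, of_run (h.mul_left κ.out⁻¹) _ _ _ _ ?_ ?_⟩ <;> simp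

end Transfer

/-! ### Cancellation in free groups -/

namespace FreeGroup

/-- A word that reduces to a single letter contains an occurrence of that letter with trivial words
on both sides. -/
theorem Red.exists_split_of_singleton {X : Type*} {s : X × Bool} {L : List (X × Bool)}
    (h : Red L [s]) : ∃ L₁ L₂, L = L₁ ++ s :: L₂ ∧ Red L₁ [] ∧ Red L₂ [] := by
  induction hn : L.length using Nat.strong_induction_on generalizing L with
  | _ n ih =>
  match L with
  | [] => simp [Red.nil_iff] at h
  | d :: L =>
    by_cases hd : d = s
    · subst hd
      exact ⟨[], L, rfl, .refl, (Red.cons_cons_iff d).1 h⟩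
    -- The tail reduces to `d⁻¹ s`, so it splits into `A`, which cancels `d`, and a shorter word `B`
    -- reducing to `s`.
    · obtain ⟨A, B, rfl, hA, hB⟩ := (Red.to_append_iff (L₁ := [(d.1, !d.2)]) (L₂ := [s])).1
        (Red.inv_of_red_of_ne hd h)
      obtain ⟨L₁, L₂, rfl, h₁, h₂⟩ := ih B.length (by simp [← hn]) hB rfl
      refine ⟨d :: A ++ L₁, L₂, by simp, ?_, h₂⟩
      simpa using Red.append_append (Red.cons_nil_iff_singleton.2 hA) h₁

theorem mk_eq_one_iff_red {X : Type*} {L : List (X × Bool)} : mk L = 1 ↔ Red L [] := by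
  rw [one_eq_mk, Red.exact]
  constructor
  · rintro ⟨L', h, h'⟩
    rwa [Red.nil_iff.1 h'] at h
  · exact fun h => ⟨[], h, .refl⟩

end FreeGroup

/-! ### Letter-emitting transition systems and balanced paths -/

/-- A transition relation whose transitions read at most one letter of the alphabet `α` and emit at
most one letter of the free group on `X`. -/
abbrev LetterRel (α X Q : Type*) := Q → Option α → Option (X × Bool) → Q → Prop

namespace LetterRel

variable {α X Q : Type*}

/-- `S.Path p w l q`: the word `w` can be read on the way from `p` to `q`, emitting `l`. -/
inductive Path (S : LetterRel α X Q) : Q → List α → List (X × Bool) → Q → Prop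
  | nil (p : Q) : Path S p [] [] p
  | cons {p p' q : Q} {σ : Option α} {c : Option (X × Bool)} {w : List α} {l : List (X × Bool)}
      (h : S p σ c p') (hp : Path S p' w l q) : Path S p (σ.toList ++ w) (c.toList ++ l) q

/-- `S.Balanced p w q`: the word `w` can be read on the way from `p` to `q`, such that the emitted
letters cancel in pairs. -/
inductive Balanced (S : LetterRel α X Q) : Q → List α → Q → Prop
  | nil (p : Q) : Balanced S p [] p
  | silent {p p' q : Q} {σ : Option α} {w : List α} (h : S p σ none p')
      (hb : Balanced S p' w q) : Balanced S p (σ.toList ++ w) q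
  | pair {p p' q' q'' q : Q} {σ τ : Option α} {x : X} {b : Bool} {w w' : List α}
      (h : S p σ (some (x, b)) p') (hb : Balanced S p' w q')
      (h' : S q' τ (some (x, !b)) q'') (hb' : Balanced S q'' w' q) :
      Balanced S p (σ.toList ++ w ++ τ.toList ++ w') q

variable {S : LetterRel α X Q}

theorem Path.append {p q r : Q} {w w' : List α} {l l' : List (X × Bool)} (h : S.Path p w l q)
    (h' : S.Path q w' l' r) : S.Path p (w ++ w') (l ++ l') r := by
  induction h with
  | nil => exact h'
  | cons hs _ ih => simpa using Path.cons hs (ih h')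

theorem Path.split {p q : Q} {w : List α} {l : List (X × Bool)} (h : S.Path p w l q)
    {c : X × Bool} {l₁ l₂ : List (X × Bool)} (hl : l = l₁ ++ c :: l₂) :
    ∃ w₁ τ w₂ p₁ p₂, w = w₁ ++ Option.toList τ ++ w₂ ∧ S.Path p w₁ l₁ p₁ ∧ S p₁ τ (some c) p₂ ∧
      S.Path p₂ w₂ l₂ q := by
  induction h generalizing l₁ with
  | nil => simp at hl
  | @cons p p' q σ d w l hs hp ih =>
    match d, l₁ with
    | none, _ =>
      obtain ⟨w₁, τ, w₂, p₁, p₂, rfl, h₁, h₂, h₃⟩ := ih hl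
      exact ⟨σ.toList ++ w₁, τ, w₂, p₁, p₂, by simp, .cons hs h₁, h₂, h₃⟩
    | some d, [] =>
      obtain ⟨rfl, rfl⟩ : d = c ∧ l = l₂ := by simpa using hl
      exact ⟨[], σ, w, p, p', by simp, .nil _, hs, hp⟩
    | some d, e :: l₁ =>
      obtain ⟨rfl, hl'⟩ : d = e ∧ l = l₁ ++ c :: l₂ := by simpa using hl
      obtain ⟨w₁, τ, w₂, p₁, p₂, rfl, h₁, h₂, h₃⟩ := ih hl'
      exact ⟨σ.toList ++ w₁, τ, w₂, p₁, p₂, by simp, .cons hs h₁, h₂, h₃⟩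

theorem Balanced.exists_path {p q : Q} {w : List α} (h : S.Balanced p w q) :
    ∃ l, S.Path p w l q ∧ FreeGroup.mk l = 1 := by
  induction h with
  | nil p => exact ⟨[], .nil p, rfl⟩
  | silent h _ ih =>
    obtain ⟨l, hl, h1⟩ := ih
    exact ⟨l, .cons (c := none) h hl, h1⟩
  | @pair p p' q' q'' q σ τ x b w w' h _ h' _ ih ih' =>
    obtain ⟨l, hl, h1⟩ := ih
    obtain ⟨l', hl', h1'⟩ := ih'
    refine ⟨(x, b) :: (l ++ (x, !b) :: l'), ?_, ?_⟩
    · simpa using Path.cons h (hl.append (Path.cons h' hl'))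
    · rw [FreeGroup.mk_eq_one_iff_red] at h1 h1' ⊢
      rw [FreeGroup.Red.cons_nil_iff_singleton]
      simpa using FreeGroup.Red.append_append h1 (FreeGroup.Red.cons_cons h1')

/-- The first emitted letter is cancelled by some later inverse letter, with trivial words between
and after them. Cutting the path there leaves two paths that emit less. -/
theorem Path.balanced_of_red {p q : Q} {w : List α} {l : List (X × Bool)} (h : S.Path p w l q)
    (hl : FreeGroup.Red l []) : S.Balanced p w q := by
  induction hn : l.length using Nat.strong_induction_on generalizing p q w l with
  | _ n ih =>
  -- The inner induction absorbs silent transitions, which do not shorten the emitted word.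
  induction h with
  | nil p => exact .nil p
  | @cons p p' q σ c w l hs hp ihp =>
    match c with
    | none => exact .silent hs (ihp hl hn)
    | some (x, b) =>
      obtain ⟨l₁, l₂, rfl, h₁, h₂⟩ :=
        (FreeGroup.Red.cons_nil_iff_singleton.1 hl).exists_split_of_singleton
      obtain ⟨w₁, τ, w₂, p₁, p₂, rfl, hp₁, hs', hp₂⟩ := hp.split rfl
      have hb := Balanced.pair hs (ih l₁.length (by simp [← hn]) hp₁ h₁ rfl) hs'
        (ih l₂.length (by simp [← hn]; omega) hp₂ h₂ rfl)
      simpa using hb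

theorem balanced_iff_exists_path {p q : Q} {w : List α} :
    S.Balanced p w q ↔ ∃ l, S.Path p w l q ∧ FreeGroup.mk l = 1 :=
  ⟨Balanced.exists_path, fun ⟨_, h, hl⟩ => h.balanced_of_red (FreeGroup.mk_eq_one_iff_red.1 hl)⟩

/-- The automaton over the free group that multiplies its register by the emitted letters. -/
noncomputable def toFA [Finite Q] [Finite X] (S : LetterRel α X Q) (start : Q) (accept : Set Q) :
    ExtendedFA (FreeGroup X) α Q :=
  .ofRel (fun q σ q' g => ∃ c, S q σ c q' ∧ g = FreeGroup.mk c.toList)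
    (fun q σ q' => (Set.finite_range fun c : Option (X × Bool) => FreeGroup.mk c.toList).subset
      (by rintro _ ⟨c, _, rfl⟩; exact ⟨c, rfl⟩)) start accept

theorem toFA_run_iff [Finite Q] [Finite X] {start : Q} {accept : Set Q} {q r : Q}
    {x y : FreeGroup X} {w : List α} :
    (S.toFA start accept).Run q x w r y ↔ ∃ l, S.Path q w l r ∧ y = x * FreeGroup.mk l := by
  constructor
  · intro h
    refine h.label_induction (motive := fun q x w =>
      ∃ l, S.Path q w l r ∧ y = x * FreeGroup.mk l) ⟨[], .nil _, by simp [← FreeGroup.one_eq_mk]⟩ ?_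
    rintro q q' x g σ w hg - ⟨l, hl, rfl⟩
    obtain ⟨c, hc, rfl⟩ := ExtendedFA.mem_ofRel_step.1 hg
    exact ⟨_, .cons hc hl, by rw [← FreeGroup.mul_mk, mul_assoc]⟩
  · rintro ⟨l, hl, rfl⟩
    induction hl generalizing x with
    | nil => simpa [← FreeGroup.one_eq_mk] using ExtendedFA.Run.refl _ _
    | cons hs _ ih =>
      refine .step (ExtendedFA.mem_ofRel_step.2 ⟨_, hs, rfl⟩) ?_
      rw [← FreeGroup.mul_mk, ← mul_assoc]
      exact ih

theorem mem_toFA_accepts_iff [Finite Q] [Finite X] {start : Q} {accept : Set Q} {w : List α} :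
    w ∈ (S.toFA start accept).accepts ↔ ∃ q ∈ accept, S.Balanced start w q := by
  simp_rw [balanced_iff_exists_path]
  refine exists_congr fun q => and_congr Iff.rfl (toFA_run_iff.trans ?_)
  simp [eq_comm, toFA, ExtendedFA.ofRel]

end LetterRel

/-! ### Grammars as systems of language inequalities -/

namespace ContextFreeGrammar

variable {T N : Type*} {g : ContextFreeGrammar T}

/-- The language denoted by a sentential form when nonterminals are interpreted by `K`. -/
def interp (K : N → Language T) (s : List (Symbol T N)) : Language T :=
  (s.map fun
    | .terminal a => ({[a]} : Language T)
    | .nonterminal A => K A).prod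

theorem interp_append (K : N → Language T) (s t : List (Symbol T N)) :
    interp K (s ++ t) = interp K s * interp K t := by
  simp [interp]

theorem interp_nonterminal (K : N → Language T) (A : N) :
    interp K [.nonterminal A] = K A := by
  simp [interp]

theorem interp_map_terminal (K : N → Language T) (w : List T) :
    interp K (w.map .terminal) = ({w} : Language T) := by
  induction w with
  | nil => rfl
  | cons a w ih =>
    rw [List.map_cons, ← List.singleton_append, interp_append, ih]
    have : interp K [.terminal a] = ({[a]} : Language T) := by simp [interp]
    rw [this]
    exact Set.image2_singleton

/-- Each rewriting replaces a factor `K r.input` of the product by something smaller. Hence any `K`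
closed under the rules bounds the generated languages from above. -/
theorem interp_le_of_derives {K : g.NT → Language T}
    (hK : ∀ r ∈ g.rules, interp K r.output ≤ K r.input) {u v : List (Symbol T g.NT)}
    (h : g.Derives u v) : interp K v ≤ interp K u := by
  induction h with
  | refl => exact le_rfl
  | tail _ hp ih =>
    refine le_trans ?_ ih
    obtain ⟨r, hr, hrw⟩ := hp
    obtain ⟨p, q, rfl, rfl⟩ := hrw.exists_parts
    simp only [interp_append, interp_nonterminal]
    gcongr
    exact hK r hr

theorem mem_of_derives {K : g.NT → Language T}
    (hK : ∀ r ∈ g.rules, interp K r.output ≤ K r.input) {A : g.NT} {w : List T}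
    (h : g.Derives [.nonterminal A] (w.map .terminal)) : w ∈ K A := by
  have := interp_le_of_derives hK h
  rw [interp_map_terminal, interp_nonterminal] at this
  exact this rfl

theorem derives_output {r : ContextFreeRule T g.NT} (hr : r ∈ g.rules) :
    g.Derives [.nonterminal r.input] r.output :=
  Produces.single ⟨r, hr, ContextFreeRule.Rewrites.input_output⟩

end ContextFreeGrammar

/-! ### A grammar for balanced words -/

namespace LetterRel

section Grammar

variable {α X : Type*} {Q : Type}

/-- The rules of a grammar for the balanced words: the nonterminal `some (p, q)` generates the
words that can be read on a balanced way from `p` to `q`. -/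
inductive IsRule (S : LetterRel α X Q) (start : Q) (accept : Set Q) :
    ContextFreeRule α (Option (Q × Q)) → Prop
  | entry {q : Q} (hq : q ∈ accept) : IsRule S start accept ⟨none, [.nonterminal (some (start, q))]⟩
  | nil (p : Q) : IsRule S start accept ⟨some (p, p), []⟩
  | silent {p p' : Q} {σ : Option α} (h : S p σ none p') (q : Q) :
      IsRule S start accept
        ⟨some (p, q), σ.toList.map .terminal ++ [.nonterminal (some (p', q))]⟩
  | pair {p p' q' q'' : Q} {σ τ : Option α} {x : X} {b : Bool} (h : S p σ (some (x, b)) p')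
      (h' : S q' τ (some (x, !b)) q'') (q : Q) :
      IsRule S start accept
        ⟨some (p, q), σ.toList.map .terminal ++ [.nonterminal (some (p', q'))] ++
          τ.toList.map .terminal ++ [.nonterminal (some (q'', q))]⟩

theorem finite_setOf_isRule [Finite α] [Finite Q] (S : LetterRel α X Q) (start : Q)
    (accept : Set Q) : {r | S.IsRule start accept r}.Finite := by
  let entry (q : Q) : ContextFreeRule α (Option (Q × Q)) :=
    ⟨none, [.nonterminal (some (start, q))]⟩
  let nil (p : Q) : ContextFreeRule α (Option (Q × Q)) := ⟨some (p, p), []⟩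
  let silent (t : Q × Q × Q × Option α) : ContextFreeRule α (Option (Q × Q)) :=
    ⟨some (t.1, t.2.1), t.2.2.2.toList.map .terminal ++ [.nonterminal (some (t.2.2.1, t.2.1))]⟩
  let pair (t : (Q × Q) × (Q × Q) × (Q × Q) × Option α × Option α) :
      ContextFreeRule α (Option (Q × Q)) :=
    ⟨some t.1, t.2.2.2.1.toList.map .terminal ++ [.nonterminal (some t.2.1)] ++
      t.2.2.2.2.toList.map .terminal ++ [.nonterminal (some t.2.2.1)]⟩
  refine ((Set.finite_range entry).union ((Set.finite_range nil).union
    ((Set.finite_range silent).union (Set.finite_range pair)))).subset ?_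
  rintro _ (hq | p | ⟨h, q⟩ | ⟨h, h', q⟩)
  · exact .inl ⟨_, rfl⟩
  · exact .inr (.inl ⟨p, rfl⟩)
  · exact .inr (.inr (.inl ⟨(_, _, _, _), rfl⟩))
  · exact .inr (.inr (.inr ⟨((_, _), (_, _), (_, _), _, _), rfl⟩))

/-- The grammar that generates the words that can be read on a balanced way from `start` to an
element of `accept`. -/
noncomputable def grammar [Finite α] [Finite Q] (S : LetterRel α X Q) (start : Q)
    (accept : Set Q) : ContextFreeGrammar α where
  NT := Option (Q × Q)
  initial := none
  rules := (S.finite_setOf_isRule start accept).toFinset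

variable [Finite α] [Finite Q] {S : LetterRel α X Q} {start : Q} {accept : Set Q}

theorem mem_grammar_rules {r : ContextFreeRule α (Option (Q × Q))} :
    r ∈ (S.grammar start accept).rules ↔ S.IsRule start accept r :=
  Set.Finite.mem_toFinset _

theorem Balanced.derives {p q : Q} {w : List α} (h : S.Balanced p w q) :
    (S.grammar start accept).Derives [.nonterminal (some (p, q))] (w.map .terminal) := by
  induction h with
  | nil p => exact ContextFreeGrammar.derives_output (mem_grammar_rules.2 (.nil p))
  | @silent p p' q σ w h _ ih =>
    refine (ContextFreeGrammar.derives_output (mem_grammar_rules.2 (.silent h q))).trans ?_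
    rw [List.map_append]
    exact ih.append_left _
  | @pair p p' q' q'' q σ τ x b w w' h _ h' _ ih ih' =>
    refine (ContextFreeGrammar.derives_output (mem_grammar_rules.2 (.pair h h' q))).trans ?_
    simp only [List.map_append]
    exact (((ih.append_left _).append_right _).append_right _).trans (ih'.append_left _)

theorem mem_grammar_language_iff {w : List α} :
    w ∈ (S.grammar start accept).language ↔ ∃ q ∈ accept, S.Balanced start w q := by
  rw [ContextFreeGrammar.mem_language_iff]
  constructor
  · let K : Option (Q × Q) → Language α := fun A => {w |
      match A with
      | none => ∃ q ∈ accept, S.Balanced start w q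
      | some (p, q) => S.Balanced p w q}
    have hK {r : ContextFreeRule α (Option (Q × Q))} (hr : S.IsRule start accept r) :
        ContextFreeGrammar.interp K r.output ≤ K r.input := by
      rcases hr with hq | p | ⟨h, q⟩ | ⟨h, h', q⟩
      · rw [ContextFreeGrammar.interp_nonterminal]
        exact fun w hw => ⟨_, hq, hw⟩
      · rintro _ rfl
        exact Balanced.nil p
      · rw [ContextFreeGrammar.interp_append, ContextFreeGrammar.interp_map_terminal,
          ContextFreeGrammar.interp_nonterminal]
        rintro _ ⟨_, rfl, w, hw, rfl⟩
        exact Balanced.silent h hw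
      · simp only [ContextFreeGrammar.interp_append, ContextFreeGrammar.interp_map_terminal,
          ContextFreeGrammar.interp_nonterminal]
        rintro _ ⟨_, ⟨_, ⟨_, rfl, w, hw, rfl⟩, _, rfl, rfl⟩, w', hw', rfl⟩
        exact Balanced.pair h hw h' hw'
    exact ContextFreeGrammar.mem_of_derives (K := K) fun r hr => hK (mem_grammar_rules.1 hr)
  · rintro ⟨q, hq, h⟩
    exact (ContextFreeGrammar.derives_output (mem_grammar_rules.2 (.entry hq))).trans h.derives

end Grammar

end LetterRel

/-! ### Splitting free group transitions into letters -/

namespace ExtendedFA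

variable {α X Q : Type*} [DecidableEq X]

/-- The transition relation that simulates an automaton over a free group letter by letter: the
letters that are still to be emitted are part of the state. -/
inductive letterRel (M : ExtendedFA (FreeGroup X) α Q) (N : ℕ) :
    LetterRel α X (Q × {l : List (X × Bool) // l.length ≤ N})
  | load {q q' : Q} {σ : Option α} {g : FreeGroup X} (h : (q', g) ∈ M.step q σ)
      (hg : g.toWord.length ≤ N) : letterRel M N (q, ⟨[], N.zero_le⟩) σ none (q', ⟨g.toWord, hg⟩)
  | emit (q : Q) {c : X × Bool} {l : List (X × Bool)} (h : (c :: l).length ≤ N)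
      (h' : l.length ≤ N) : letterRel M N (q, ⟨c :: l, h⟩) none (some c) (q, ⟨l, h'⟩)

theorem letterRel_path_emit (M : ExtendedFA (FreeGroup X) α Q) {N : ℕ} (q : Q)
    (l : List (X × Bool)) (hl : l.length ≤ N) :
    (M.letterRel N).Path (q, ⟨l, hl⟩) [] l (q, ⟨[], N.zero_le⟩) := by
  induction l with
  | nil => exact .nil _
  | cons c l ih =>
    exact .cons (σ := none) (.emit q hl ((Nat.le_succ _).trans hl)) (ih ((Nat.le_succ _).trans hl))

theorem run_iff_letterRel_path {M : ExtendedFA (FreeGroup X) α Q} {N : ℕ}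
    (hN : ∀ q σ q' g, (q', g) ∈ M.step q σ → g.toWord.length ≤ N) {q r : Q} {x y : FreeGroup X}
    {w : List α} :
    M.Run q x w r y ↔ ∃ l, (M.letterRel N).Path (q, ⟨[], N.zero_le⟩) w l (r, ⟨[], N.zero_le⟩) ∧
      y = x * FreeGroup.mk l := by
  constructor
  · intro h
    refine h.label_induction (motive := fun q x w => ∃ l, (M.letterRel N).Path
      (q, ⟨[], N.zero_le⟩) w l (r, ⟨[], N.zero_le⟩) ∧ y = x * FreeGroup.mk l)
      ⟨[], .nil _, by simp [← FreeGroup.one_eq_mk]⟩ ?_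
    rintro q q' x g σ w hg - ⟨l, hl, rfl⟩
    have hgN := hN _ _ _ _ hg
    refine ⟨g.toWord ++ l,
      .cons (c := none) (.load hg hgN) ((M.letterRel_path_emit q' g.toWord hgN).append hl), ?_⟩
    rw [← FreeGroup.mul_mk, FreeGroup.mk_toWord, mul_assoc]
  -- Pending letters count as already multiplied into the register of `M`: `load` is then a
  -- transition of `M`, and `emit` changes nothing.
  · have key {s t : Q × {l : List (X × Bool) // l.length ≤ N}} {w : List α}
        {l : List (X × Bool)} (h : (M.letterRel N).Path s w l t) :
        t = (r, ⟨[], N.zero_le⟩) → ∀ x : FreeGroup X,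
          M.Run s.1 (x * FreeGroup.mk s.2.1) w r (x * FreeGroup.mk l) := by
      induction h with
      | nil => rintro rfl x; exact .refl _ _
      | @cons p p' t σ c w l hs _ ih =>
        intro ht x
        cases hs with
        | @load q q' _ g h hg =>
          refine .step h ?_
          have := ih ht x
          rw [FreeGroup.mk_toWord] at this
          simpa [← FreeGroup.one_eq_mk] using this
        | @emit q c l' h h' =>
          have := ih ht (x * FreeGroup.mk [c])
          simpa [mul_assoc, FreeGroup.mul_mk] using this
    rintro ⟨l, hl, rfl⟩
    simpa [← FreeGroup.one_eq_mk] using key hl rfl x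

end ExtendedFA

theorem groupAutomatonLanguages_freeGroup_subset (X : Type) [Finite X] (α : Type*) [Finite α] :
    groupAutomatonLanguages (FreeGroup X) α ⊆ contextFreeLanguages α := by
  classical
  rintro _ ⟨Q, hQ, M, rfl⟩
  obtain ⟨N, hN⟩ : ∃ N, ∀ q σ q' g, (q', g) ∈ M.step q σ → g.toWord.length ≤ N := by
    have hfin : (⋃ q, ⋃ σ, (fun p : Q × FreeGroup X => p.2.toWord.length) ''
        (M.step q σ : Set (Q × FreeGroup X))).Finite :=
      Set.finite_iUnion fun q => Set.finite_iUnion fun σ => (M.step q σ).finite_toSet.image _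
    obtain ⟨N, hN⟩ := hfin.bddAbove
    refine ⟨N, fun q σ q' g h => hN ?_⟩
    exact Set.mem_iUnion.2 ⟨q, Set.mem_iUnion.2 ⟨σ, _, h, rfl⟩⟩
  have : Finite {l : List (X × Bool) // l.length ≤ N} := List.finite_length_le _ N
  refine ⟨(M.letterRel N).grammar (M.start, ⟨[], N.zero_le⟩)
    ((fun q => (q, ⟨[], N.zero_le⟩)) '' M.accept), ?_⟩
  ext w
  rw [LetterRel.mem_grammar_language_iff, Set.exists_mem_image]
  refine exists_congr fun q => and_congr Iff.rfl ?_
  rw [ExtendedFA.run_iff_letterRel_path hN, LetterRel.balanced_iff_exists_path]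
  simp [eq_comm]

/-! ### Embedding countably generated free groups in `F₂` -/

/-- The conjugates `aⁿ b a⁻ⁿ` are free: sending `a` to the shift and `b` to the generator `0` in
`FreeGroup ℤ ⋊ ℤ` turns them into the distinct free generators `n`. -/
theorem exists_freeGroup_nat_embedding :
    ∃ f : FreeGroup ℕ →* FreeGroup (Fin 2), Function.Injective f := by
  let shift : MulAut (FreeGroup ℤ) := FreeGroup.freeGroupCongr (Equiv.addRight 1)
  have hshift (n : ℕ) : (shift ^ n) (FreeGroup.of 0) = FreeGroup.of (n : ℤ) := by
    induction n with
    | zero => simp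
    | succ n ih => rw [pow_succ', MulAut.mul_apply, ih]; simp [shift]
  let φ : Multiplicative ℤ →* MulAut (FreeGroup ℤ) := zpowersHom _ shift
  let s : FreeGroup ℤ ⋊[φ] Multiplicative ℤ := SemidirectProduct.inr (Multiplicative.ofAdd 1)
  let t : FreeGroup ℤ ⋊[φ] Multiplicative ℤ := SemidirectProduct.inl (FreeGroup.of 0)
  let f : FreeGroup ℕ →* FreeGroup (Fin 2) :=
    FreeGroup.lift fun n => FreeGroup.of 0 ^ n * FreeGroup.of 1 * (FreeGroup.of 0 ^ n)⁻¹
  let ψ : FreeGroup (Fin 2) →* FreeGroup ℤ ⋊[φ] Multiplicative ℤ := FreeGroup.lift ![s, t]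
  have key : ψ.comp f = SemidirectProduct.inl.comp (FreeGroup.map ((↑) : ℕ → ℤ)) := by
    ext1 n
    have h : φ (Multiplicative.ofAdd 1 ^ n) (FreeGroup.of 0) = FreeGroup.of (n : ℤ) := by
      rw [map_pow, ← hshift]
      simp [φ]
    simp only [MonoidHom.comp_apply, FreeGroup.map.of, f, FreeGroup.lift_apply_of, map_mul,
      map_pow, map_inv, ψ, Matrix.cons_val_zero, Matrix.cons_val_one, s, t]
    rw [← h, SemidirectProduct.inl_aut, map_inv, map_pow]
  refine ⟨f, Function.Injective.of_comp (f := ψ) ?_⟩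
  rw [← MonoidHom.coe_comp, key]
  exact SemidirectProduct.inl_injective.comp (FreeGroup.map_injective Nat.cast_injective)

theorem exists_freeGroup_embedding (X : Type*) [Countable X] :
    ∃ f : FreeGroup X →* FreeGroup (Fin 2), Function.Injective f := by
  obtain ⟨f, hf⟩ := exists_freeGroup_nat_embedding
  obtain ⟨i, hi⟩ := exists_injective_nat X
  exact ⟨f.comp (FreeGroup.map i), hf.comp (FreeGroup.map_injective hi)⟩

/-! ### The Sanov subgroup -/

namespace Sanov

open scoped Matrix

/-- The generators of the Sanov subgroup of `SL(2, ℤ)`. -/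
def gen : Fin 2 → Matrix.SpecialLinearGroup (Fin 2) ℤ :=
  ![⟨!![1, 2; 0, 1], by simp⟩, ⟨!![1, 0; 2, 1], by simp⟩]

theorem gen_zero_zpow_mul (k : ℤ) (A : Matrix.SpecialLinearGroup (Fin 2) ℤ) :
    ((gen 0 ^ k * A : Matrix.SpecialLinearGroup (Fin 2) ℤ) : Matrix (Fin 2) (Fin 2) ℤ) =
      !![A 0 0 + 2 * k * A 1 0, A 0 1 + 2 * k * A 1 1; A 1 0, A 1 1] := by
  have h : ((gen 0 ^ k : Matrix.SpecialLinearGroup (Fin 2) ℤ) : Matrix (Fin 2) (Fin 2) ℤ) =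
      !![1, 2 * k; 0, 1] := by
    induction k with
    | zero => ext i j; fin_cases i <;> fin_cases j <;> simp
    | succ n ih =>
      rw [zpow_add_one, Matrix.SpecialLinearGroup.coe_mul, ih]
      ext i j; fin_cases i <;> fin_cases j <;> simp [gen, Matrix.mul_apply]; ring
    | pred n ih =>
      rw [zpow_sub_one, Matrix.SpecialLinearGroup.coe_mul, ih, Matrix.SpecialLinearGroup.coe_inv]
      ext i j; fin_cases i <;> fin_cases j <;> simp [gen, Matrix.mul_apply]; ring
  rw [Matrix.SpecialLinearGroup.coe_mul, h]
  ext i j; fin_cases i <;> fin_cases j <;> simp [Matrix.mul_apply]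

theorem gen_one_zpow_mul (k : ℤ) (A : Matrix.SpecialLinearGroup (Fin 2) ℤ) :
    ((gen 1 ^ k * A : Matrix.SpecialLinearGroup (Fin 2) ℤ) : Matrix (Fin 2) (Fin 2) ℤ) =
      !![A 0 0, A 0 1; A 1 0 + 2 * k * A 0 0, A 1 1 + 2 * k * A 0 1] := by
  have h : ((gen 1 ^ k : Matrix.SpecialLinearGroup (Fin 2) ℤ) : Matrix (Fin 2) (Fin 2) ℤ) =
      !![1, 0; 2 * k, 1] := by
    induction k with
    | zero => ext i j; fin_cases i <;> fin_cases j <;> simp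
    | succ n ih =>
      rw [zpow_add_one, Matrix.SpecialLinearGroup.coe_mul, ih]
      ext i j; fin_cases i <;> fin_cases j <;> simp [gen, Matrix.mul_apply]; ring
    | pred n ih =>
      rw [zpow_sub_one, Matrix.SpecialLinearGroup.coe_mul, ih, Matrix.SpecialLinearGroup.coe_inv]
      ext i j; fin_cases i <;> fin_cases j <;> simp [gen, Matrix.mul_apply]; ring
  rw [Matrix.SpecialLinearGroup.coe_mul, h]
  ext i j; fin_cases i <;> fin_cases j <;> simp [Matrix.mul_apply, add_comm]

theorem det_eq (A : Matrix.SpecialLinearGroup (Fin 2) ℤ) : A 0 0 * A 1 1 - A 0 1 * A 1 0 = 1 := by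
  rw [← Matrix.det_fin_two]
  exact A.det_coe

/-- Ping-pong under left multiplication, on the first column `(a, c)`. `gen 0` adds `2` to `a / c`,
and `X 0`, `Y 0` say `a / c ≥ 1` (or `c = 0`) and `a / c < -1`. `gen 1` adds `2` to `c / a`, with `c
/ a > 1` (or `a = 0`) and `c / a ≤ -1`. The choice of strict inequalities makes the sets disjoint.
-/
theorem lift_gen_injective : Function.Injective (FreeGroup.lift gen) := by
  let X : Fin 2 → Set (Matrix.SpecialLinearGroup (Fin 2) ℤ) :=
    ![{A | A 1 0 * A 1 0 ≤ A 0 0 * A 1 0},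
      {A | A 0 0 = 0 ∨ A 0 0 * A 0 0 < A 0 0 * A 1 0}]
  let Y : Fin 2 → Set (Matrix.SpecialLinearGroup (Fin 2) ℤ) :=
    ![{A | A 0 0 * A 1 0 < -(A 1 0 * A 1 0)},
      {A | A 0 0 ≠ 0 ∧ A 0 0 * A 1 0 ≤ -(A 0 0 * A 0 0)}]
  have mem_X0 (A : Matrix.SpecialLinearGroup (Fin 2) ℤ) :
      A ∈ X 0 ↔ A 1 0 * A 1 0 ≤ A 0 0 * A 1 0 := Iff.rfl
  have mem_X1 (A : Matrix.SpecialLinearGroup (Fin 2) ℤ) :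
      A ∈ X 1 ↔ A 0 0 = 0 ∨ A 0 0 * A 0 0 < A 0 0 * A 1 0 := Iff.rfl
  have mem_Y0 (A : Matrix.SpecialLinearGroup (Fin 2) ℤ) :
      A ∈ Y 0 ↔ A 0 0 * A 1 0 < -(A 1 0 * A 1 0) := Iff.rfl
  have mem_Y1 (A : Matrix.SpecialLinearGroup (Fin 2) ℤ) :
      A ∈ Y 1 ↔ A 0 0 ≠ 0 ∧ A 0 0 * A 1 0 ≤ -(A 0 0 * A 0 0) := Iff.rfl
  clear_value X Y
  have hcol (A : Matrix.SpecialLinearGroup (Fin 2) ℤ) (h0 : A 0 0 = 0) (h1 : A 1 0 = 0) :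
      False := by
    have := det_eq A
    simp [h0, h1] at this
  have hX01 : Disjoint (X 0) (X 1) := by
    rw [Set.disjoint_left]
    intro A h h'
    rw [mem_X0] at h
    rcases (mem_X1 A).1 h' with h0 | h1
    · exact hcol A h0 (by rw [h0] at h; nlinarith)
    · nlinarith [sq_nonneg (A 0 0 - A 1 0)]
  have hY01 : Disjoint (Y 0) (Y 1) := by
    rw [Set.disjoint_left]
    intro A h h'
    rw [mem_Y0] at h
    rw [mem_Y1] at h'
    nlinarith [sq_nonneg (A 0 0 + A 1 0)]
  refine FreeGroup.injective_lift_of_ping_pong gen X Y ?_ ?_ ?_ ?_ ?_ ?_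
  · rw [Fin.forall_fin_two]
    refine ⟨⟨1, ?_⟩, ⟨⟨!![0, -1; 1, 0], by simp⟩, ?_⟩⟩
    · simp [mem_X0]
    · exact (mem_X1 _).2 (.inl rfl)
  · intro i j hij
    fin_cases i <;> fin_cases j
    · exact absurd rfl hij
    · exact hX01
    · exact hX01.symm
    · exact absurd rfl hij
  · intro i j hij
    fin_cases i <;> fin_cases j
    · exact absurd rfl hij
    · exact hY01
    · exact hY01.symm
    · exact absurd rfl hij
  · simp only [Fin.forall_fin_two, Set.disjoint_left, mem_X0, mem_X1, mem_Y0, mem_Y1]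
    refine ⟨⟨fun A h h' => ?_, fun A h h' => ?_⟩, fun A h h' => ?_, fun A h h' => ?_⟩
    · nlinarith [mul_self_nonneg (A 1 0)]
    · have := mul_self_pos.2 h'.1
      nlinarith [mul_self_nonneg (A 1 0)]
    · rcases h with h | h
      · rw [h] at h'
        nlinarith [mul_self_nonneg (A 1 0)]
      · nlinarith [mul_self_nonneg (A 1 0), mul_self_nonneg (A 0 0)]
    · rcases h with h | h
      · exact h'.1 h
      · nlinarith [mul_self_nonneg (A 0 0)]
  · rw [Fin.forall_fin_two]
    constructor
    · rintro _ ⟨A, hA, rfl⟩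
      have h := gen_zero_zpow_mul 1 A
      rw [zpow_one] at h
      rw [Set.mem_compl_iff, mem_Y0] at hA
      simp only [mem_X0, smul_eq_mul, h]
      simp
      nlinarith
    · rintro _ ⟨A, hA, rfl⟩
      have h := gen_one_zpow_mul 1 A
      rw [zpow_one] at h
      rw [Set.mem_compl_iff, mem_Y1, not_and, not_le] at hA
      simp only [mem_X1, smul_eq_mul, h]
      simp
      by_cases h0 : A 0 0 = 0
      · exact .inl h0
      · right
        nlinarith [hA h0]
  · rw [Fin.forall_fin_two]
    constructor
    · rintro _ ⟨A, hA, rfl⟩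
      have h := gen_zero_zpow_mul (-1) A
      rw [zpow_neg_one] at h
      rw [Set.mem_compl_iff, mem_X0] at hA
      simp only [mem_Y0, smul_eq_mul, Pi.inv_apply, h]
      simp
      nlinarith
    · rintro _ ⟨A, hA, rfl⟩
      have h := gen_one_zpow_mul (-1) A
      rw [zpow_neg_one] at h
      rw [Set.mem_compl_iff, mem_X1, not_or] at hA
      simp only [mem_Y1, smul_eq_mul, Pi.inv_apply, h]
      simp
      exact ⟨hA.1, by nlinarith [hA.2]⟩

/-- The Sanov subgroup contains all matrices whose diagonal entries are congruent to `1` modulo `4`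
and whose other entries are even. -/
theorem mem_range_lift_gen (A : Matrix.SpecialLinearGroup (Fin 2) ℤ) (h00 : A 0 0 % 4 = 1)
    (h11 : A 1 1 % 4 = 1) (h01 : A 0 1 % 2 = 0) (h10 : A 1 0 % 2 = 0) :
    A ∈ (FreeGroup.lift gen).range := by
  induction hn : (A 0 0).natAbs + (A 1 0).natAbs using Nat.strong_induction_on generalizing A with
  | _ n ih =>
  have hgen (i : Fin 2) (k : ℤ) : gen i ^ k ∈ (FreeGroup.lift gen).range :=
    zpow_mem (MonoidHom.mem_range.2 ⟨FreeGroup.of i, FreeGroup.lift_apply_of⟩) k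
  by_cases hc : A 1 0 = 0
  · have hd := det_eq A
    have hA : A = gen 0 ^ (A 0 1 / 2) := by
      rw [hc, mul_zero, sub_zero] at hd
      have ha : A 0 0 = 1 := by
        rcases Int.eq_one_or_neg_one_of_mul_eq_one hd with h | h
        · exact h
        · rw [h] at h00; omega
      have hdd : A 1 1 = 1 := by rwa [ha, one_mul] at hd
      have h := gen_zero_zpow_mul (A 0 1 / 2) 1
      rw [mul_one] at h
      ext i j
      rw [h]
      have hb : 2 * (A 0 1 / 2) = A 0 1 := by omega
      fin_cases i <;> fin_cases j <;> simp [ha, hdd, hc, hb]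
    rw [hA]
    exact hgen _ _
  -- Euclidean descent: adding `±2` times the smaller entry of the first column to the larger one
  -- shrinks it. Equal absolute values cannot occur, as `A 0 0` is odd and `A 1 0` even.
  · rcases lt_or_ge (A 1 0).natAbs (A 0 0).natAbs with hlt | hge
    · obtain ⟨k, hk, hk1⟩ : ∃ k : ℤ, (A 0 0 + 2 * k * A 1 0).natAbs < (A 0 0).natAbs ∧
          (k = 1 ∨ k = -1) := by
        by_cases hs : 0 ≤ A 0 0 ↔ 0 ≤ A 1 0
        · exact ⟨-1, by omega, .inr rfl⟩
        · exact ⟨1, by omega, .inl rfl⟩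
      have h := gen_zero_zpow_mul k A
      rw [← mul_mem_cancel_left (hgen 0 k)]
      refine ih _ ?_ _ ?_ ?_ ?_ ?_ rfl <;> rw [h] <;> simp <;> rcases hk1 with rfl | rfl <;> omega
    · obtain ⟨k, hk, hk1⟩ : ∃ k : ℤ, (A 1 0 + 2 * k * A 0 0).natAbs < (A 1 0).natAbs ∧
          (k = 1 ∨ k = -1) := by
        by_cases hs : 0 ≤ A 0 0 ↔ 0 ≤ A 1 0
        · exact ⟨-1, by omega, .inr rfl⟩
        · exact ⟨1, by omega, .inl rfl⟩
      have h := gen_one_zpow_mul k A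
      rw [← mul_mem_cancel_left (hgen 1 k)]
      refine ih _ ?_ _ ?_ ?_ ?_ ?_ rfl <;> rw [h] <;> simp <;> rcases hk1 with rfl | rfl <;> omega

/-- The Sanov embedding of the free group of rank two into `GL(2, ℤ)`. -/
noncomputable def toGL : FreeGroup (Fin 2) →* Matrix.GeneralLinearGroup (Fin 2) ℤ :=
  Matrix.SpecialLinearGroup.toGL.comp (FreeGroup.lift gen)

theorem toGL_injective : Function.Injective toGL :=
  Matrix.SpecialLinearGroup.toGL_injective.comp lift_gen_injective

/-- A matrix congruent to `1` modulo `4` has determinant `1` rather than `-1`, so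
`mem_range_lift_gen` applies. The kernel has finite index since its target group is finite. -/
theorem ker_map_le_range_toGL :
    (Matrix.GeneralLinearGroup.map (n := Fin 2) (Int.castRingHom (ZMod 4))).ker ≤ toGL.range := by
  intro A hA
  have hentry (i j : Fin 2) :
      ((A i j : ℤ) : ZMod 4) = (1 : Matrix (Fin 2) (Fin 2) (ZMod 4)) i j := by
    have := congrArg (fun B : Matrix.GeneralLinearGroup (Fin 2) (ZMod 4) => B i j)
      (MonoidHom.mem_ker.1 hA)
    simpa using this
  have h00 : A 0 0 % 4 = 1 := (ZMod.intCast_eq_intCast_iff _ 1 4).1 (by simpa using hentry 0 0)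
  have h11 : A 1 1 % 4 = 1 := (ZMod.intCast_eq_intCast_iff _ 1 4).1 (by simpa using hentry 1 1)
  have h01 : A 0 1 % 4 = 0 := (ZMod.intCast_eq_intCast_iff _ 0 4).1 (by simpa using hentry 0 1)
  have h10 : A 1 0 % 4 = 0 := (ZMod.intCast_eq_intCast_iff _ 0 4).1 (by simpa using hentry 1 0)
  have hdet : (A : Matrix (Fin 2) (Fin 2) ℤ).det = 1 := by
    have hu : IsUnit (A : Matrix (Fin 2) (Fin 2) ℤ).det :=
      (Matrix.isUnit_iff_isUnit_det _).1 A.isUnit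
    rcases Int.isUnit_iff.1 hu with h | h
    · exact h
    · rw [Matrix.det_fin_two] at h
      have h1 := Int.mul_emod (A 0 0) (A 1 1) 4
      have h2 := Int.mul_emod (A 0 1) (A 1 0) 4
      rw [h00, h11] at h1
      rw [h01, h10] at h2
      omega
  obtain ⟨x, hx⟩ := mem_range_lift_gen ⟨A, hdet⟩ h00 h11 (by simp; omega) (by simp; omega)
  refine ⟨x, ?_⟩
  ext i j
  simp only [toGL, MonoidHom.comp_apply, hx]
  rfl

instance : toGL.range.FiniteIndex :=
  Subgroup.finiteIndex_of_le ker_map_le_range_toGL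

end Sanov

/-! ### A parser with a free group as its stack -/

/-- The states of a recursive descent parser for grammar rules that are indexed by `ι`:
`inRule k i` means that the first `i` symbols of the output of the rule `k` have been matched. -/
inductive ParserState (ι : Type) (m : ℕ)
  | start : ParserState ι m
  | done : ParserState ι m
  | inRule (k : ι) (i : Fin (m + 1)) : ParserState ι m

namespace ParserState

open ContextFreeGrammar

instance (ι : Type) [Finite ι] (m : ℕ) : Finite (ParserState ι m) := by
  refine Finite.of_injective (β := Option (Option (ι × Fin (m + 1)))) (fun
    | start => none
    | done => some none
    | inRule k i => some (some (k, i))) ?_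
  rintro (_ | _ | _) (_ | _ | _) h <;> simp_all

variable {α : Type*} {ι : Type} {g : ContextFreeGrammar α} {m : ℕ}

/-- The transitions of the recursive descent parser. The return address is pushed before a
nonterminal is parsed, and popped afterwards. -/
inductive Step (ρ : ι → ContextFreeRule α g.NT) :
    LetterRel α (ι × Fin (m + 1)) (ParserState ι m)
  | entry {k : ι} (hk : (ρ k).input = g.initial) : Step ρ start none none (inRule k 0)
  | read {k : ι} {i j : Fin (m + 1)} {a : α} (ha : (ρ k).output[i.val]? = some (.terminal a))
      (hj : j.val = i.val + 1) : Step ρ (inRule k i) (some a) none (inRule k j)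
  | push {k k' : ι} {i : Fin (m + 1)}
      (hk : (ρ k).output[i.val]? = some (.nonterminal (ρ k').input)) :
      Step ρ (inRule k i) none (some ((k, i), true)) (inRule k' 0)
  | finish {k : ι} {i : Fin (m + 1)} (hi : i.val = (ρ k).output.length) :
      Step ρ (inRule k i) none none done
  | pop {k : ι} {i j : Fin (m + 1)} (hj : j.val = i.val + 1) :
      Step ρ done none (some ((k, i), false)) (inRule k j)

/-- What a balanced computation of the parser has achieved. -/
def Sound (ρ : ι → ContextFreeRule α g.NT) (w : List α) (t : ParserState ι m) :
    ParserState ι m → Prop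
  | start => t = done → g.Derives [.nonterminal g.initial] (w.map .terminal)
  | done => t = done ∧ w = []
  | inRule k i => (∃ j, t = inRule k j ∧ i ≤ j) ∨
      t = done ∧ g.Derives ((ρ k).output.drop i) (w.map .terminal)

/-- Unlike a stack, a group register also allows a pop that a later push cancels. This would lead in
a balanced way from position `i + 1` of a rule back to position `i`; the first alternative in
`Sound` excludes it, as positions never decrease. -/
theorem sound_of_balanced {ρ : ι → ContextFreeRule α g.NT} (hρ : ∀ k, ρ k ∈ g.rules)
    {s t : ParserState ι m} {w : List α} (h : (Step ρ).Balanced s w t) : Sound ρ w t s := by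
  induction h with
  | nil p =>
    match p with
    | start => exact fun h => nomatch h
    | done => exact ⟨rfl, rfl⟩
    | inRule k i => exact .inl ⟨i, rfl, le_rfl⟩
  | @silent p p' t σ w h _ ih =>
    cases h with
    | @entry k hk =>
      rintro rfl
      rcases ih with ⟨j, hj, -⟩ | ⟨-, hd⟩
      · exact nomatch hj
      · rw [← hk]
        exact (derives_output (hρ k)).trans (by simpa using hd)
    | @read k i j a ha hj =>
      rcases ih with ⟨l, rfl, hl⟩ | ⟨rfl, hd⟩
      · exact .inl ⟨l, rfl, by omega⟩
      · refine .inr ⟨rfl, ?_⟩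
        obtain ⟨hi, ha⟩ := List.getElem?_eq_some_iff.1 ha
        rw [List.drop_eq_getElem_cons hi, ha, ← hj]
        exact hd.append_left [.terminal a]
    | @finish k i hi =>
      obtain ⟨rfl, rfl⟩ := ih
      exact .inr ⟨rfl, by rw [hi, List.drop_length]; rfl⟩
  | @pair p p' q' q'' t σ τ x b w w' h _ h' _ ih ih' =>
    cases h with
    | @push k k' i hk =>
      generalize hc : some ((k, i), !true) = c at h'
      cases h' with
      | entry | read | finish | push => simp at hc
      | @pop k₁ i₁ j hj =>
        obtain ⟨rfl, rfl⟩ : k = k₁ ∧ i = i₁ := by simpa using hc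
        obtain ⟨_, hl, -⟩ | ⟨-, hd⟩ := ih
        · exact nomatch hl
        rcases ih' with ⟨l, rfl, hl⟩ | ⟨rfl, hd'⟩
        · exact .inl ⟨l, rfl, by omega⟩
        · refine .inr ⟨rfl, ?_⟩
          obtain ⟨hi, hk⟩ := List.getElem?_eq_some_iff.1 hk
          rw [List.drop_eq_getElem_cons hi, hk, ← hj]
          have hd₁ := (derives_output (hρ k')).trans (by simpa using hd)
          simpa using (hd₁.append_right _).trans (hd'.append_left _)
    | @pop k i j hj =>
      generalize hc : some ((k, i), !false) = c at h'
      cases h' with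
      | entry | read | finish | pop => simp at hc
      | @push k₁ k' i₁ hk =>
        obtain ⟨rfl, rfl⟩ : k = k₁ ∧ i = i₁ := by simpa using hc
        obtain ⟨l, hl, hjl⟩ | ⟨hl, -⟩ := ih
        · obtain ⟨-, rfl⟩ := ParserState.inRule.inj hl
          omega
        · exact nomatch hl

/-- The parser walks through the rest of the output, and `hK` supplies the calls for nonterminals.
Applied to the parsable words as `K`, this shows that they are closed under the rules. -/
theorem balanced_of_mem_interp {ρ : ι → ContextFreeRule α g.NT}
    (hm : ∀ k, (ρ k).output.length ≤ m) {K : g.NT → Language α}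
    (hK : ∀ A, ∀ w ∈ K A, ∃ k, (ρ k).input = A ∧ (Step ρ).Balanced (inRule (m := m) k 0) w done)
    (k : ι) {s : List (Symbol α g.NT)} {i : Fin (m + 1)} (hi : i.val ≤ (ρ k).output.length)
    (hs : (ρ k).output.drop i = s) {w : List α} (hw : w ∈ interp K s) :
    (Step ρ).Balanced (inRule k i) w done := by
  induction s generalizing i w with
  | nil =>
    obtain rfl : w = [] := hw
    rw [List.drop_eq_nil_iff] at hs
    exact .silent (σ := none) (.finish (le_antisymm hi hs)) (.nil _)
  | cons x s ih =>
    have hlt : i.val < (ρ k).output.length := by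
      by_contra hlt
      rw [List.drop_eq_nil_of_le (not_lt.1 hlt)] at hs
      exact nomatch hs
    rw [List.drop_eq_getElem_cons hlt, List.cons.injEq] at hs
    have hx : (ρ k).output[i.val]? = some x := List.getElem?_eq_some_iff.2 ⟨hlt, hs.1⟩
    let j : Fin (m + 1) := ⟨i + 1, by have := hm k; omega⟩
    rw [← List.singleton_append, interp_append] at hw
    obtain ⟨w₁, hw₁, w₂, hw₂, rfl⟩ := hw
    have hb := ih (i := j) hlt hs.2 hw₂
    match x with
    | .terminal a =>
      obtain rfl : w₁ = [a] := by
        have := interp_map_terminal K [a]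
        rw [List.map_singleton] at this
        rw [this] at hw₁
        exact hw₁
      exact .silent (.read hx rfl) hb
    | .nonterminal A =>
      rw [interp_nonterminal] at hw₁
      obtain ⟨k', rfl, hb'⟩ := hK A w₁ hw₁
      simpa using LetterRel.Balanced.pair (.push hx) hb' (.pop (j := j) rfl) hb

theorem balanced_iff_mem_language {ρ : ι → ContextFreeRule α g.NT}
    (hρ : ∀ r, r ∈ g.rules ↔ ∃ k, ρ k = r) (hm : ∀ k, (ρ k).output.length ≤ m) {w : List α} :
    (Step ρ).Balanced (start (m := m)) w done ↔ w ∈ g.language := by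
  rw [mem_language_iff]
  constructor
  · exact fun h => sound_of_balanced (fun k => (hρ _).2 ⟨k, rfl⟩) h rfl
  · intro h
    let K : g.NT → Language α := fun A =>
      {w | ∃ k, (ρ k).input = A ∧ (Step ρ).Balanced (inRule (m := m) k 0) w done}
    obtain ⟨k, hk, hb⟩ : w ∈ K g.initial := by
      refine mem_of_derives (fun r hr w hw => ?_) h
      obtain ⟨k, rfl⟩ := (hρ r).1 hr
      exact ⟨k, rfl, balanced_of_mem_interp hm (fun A w hw => hw) k (Nat.zero_le _)
        List.drop_zero hw⟩
    exact .silent (σ := none) (.entry hk) hb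

end ParserState

theorem contextFreeLanguages_subset (α : Type*) :
    contextFreeLanguages α ⊆ groupAutomatonLanguages (FreeGroup (Fin 2)) α := by
  rintro _ ⟨g, rfl⟩
  let ρ : Fin g.rules.card → ContextFreeRule α g.NT := fun k => (g.rules.equivFin.symm k).1
  have hρ (r : ContextFreeRule α g.NT) : r ∈ g.rules ↔ ∃ k, ρ k = r :=
    ⟨fun hr => ⟨g.rules.equivFin ⟨r, hr⟩, by simp [ρ]⟩, by rintro ⟨k, rfl⟩; exact Subtype.prop _⟩
  obtain ⟨m, hm⟩ : ∃ m, ∀ k, (ρ k).output.length ≤ m := by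
    obtain ⟨m, hm⟩ := (Set.finite_range fun k => (ρ k).output.length).bddAbove
    exact ⟨m, fun k => hm ⟨k, rfl⟩⟩
  -- One free generator per return address (rule, position).
  obtain ⟨f, hf⟩ := exists_freeGroup_embedding (Fin g.rules.card × Fin (m + 1))
  refine groupAutomatonLanguages_subset_of_injective f hf α
    ⟨ParserState _ m, inferInstance, LetterRel.toFA (ParserState.Step ρ) .start {.done}, ?_⟩
  ext w
  rw [LetterRel.mem_toFA_accepts_iff, ← ParserState.balanced_iff_mem_language hρ hm]
  simp

theorem mainTheorem1 (α : Type*) [Finite α] :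
    contextFreeLanguages α = groupAutomatonLanguages (FreeGroup (Fin 2)) α ∧
    groupAutomatonLanguages (FreeGroup (Fin 2)) α =
      groupAutomatonLanguages (Matrix.SpecialLinearGroup (Fin 2) ℤ) α ∧
    groupAutomatonLanguages (Matrix.SpecialLinearGroup (Fin 2) ℤ) α =
      groupAutomatonLanguages (Matrix.GeneralLinearGroup (Fin 2) ℤ) α := by
  have hCF := groupAutomatonLanguages_freeGroup_subset (Fin 2) α
  have hSL := groupAutomatonLanguages_subset_of_injective _ Sanov.lift_gen_injective α
  have hGL := groupAutomatonLanguages_subset_of_injective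
    (Matrix.SpecialLinearGroup.toGL (n := Fin 2) (R := ℤ))
    Matrix.SpecialLinearGroup.toGL_injective α
  have hF : groupAutomatonLanguages (Matrix.GeneralLinearGroup (Fin 2) ℤ) α ⊆
      groupAutomatonLanguages (FreeGroup (Fin 2)) α :=
    (groupAutomatonLanguages_subset_of_finiteIndex Sanov.toGL.range α).trans
      (groupAutomatonLanguages_subset_of_injective
        (MonoidHom.ofInjective Sanov.toGL_injective).symm.toMonoidHom
        (MulEquiv.injective _) α)
  exact ⟨(contextFreeLanguages_subset α).antisymm hCF, hSL.antisymm (hGL.trans hF),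
    hGL.antisymm (hF.trans hSL)⟩
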